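/- Let $\nu\in(0,\pi)$. There is a constant $C=C(\nu)<\infty$ such that the following holds for every $n\ge 2$ and every $0<\delta\le 1$ (in particular for every $\delta$ much smaller than $\nu$). Let $B_1,B_2\subset\mathbb R^n$ be closed rectangular boxes, arbitrarily placed and rotated, each having one (short) side of length $\delta^2$ and the other $n-1$ sides of length $\delta$, and suppose that unit vectors $a_1,a_2$ along the short sides of $B_1,B_2$ form the angle $\nu$, i.e. $a_1\cdot a_2=\cos\nu$. Let $f_1,f_2:\mathbb R^n\to\mathbb C$ be functions, each in $L^1(\mathbb R^n)$ or in $L^2(\mathbb R^n)$, whose Fourier transforms ($\widehat f(\xi)=\int_{\mathbb R^n} f(x)e^{-2\pi i x\cdot\xi}\,dx$ for $f\in L^1$, and its Plancherel extension for $f\in L^2$) are supported in $B_1$ and $B_2$ respectively. Then $$\big\||f_1f_2|^{1/2}\big\|_{L^4(\mathbb R^n)}\le C\,\delta^{\frac{n+2}{4}}\big(\|f_1\|_{L^2(\mathbb R^n)}\|f_2\|_{L^2(\mathbb R^n)}\big)^{1/2}.$$ -/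

import Mathlib

/-- A rectangular box in `ℝⁿ`: a centre, an orthonormal frame of axes, and the (full) side length
along each axis. -/
structure RectBox (n : ℕ) where
  center : EuclideanSpace ℝ (Fin n)
  axes : OrthonormalBasis (Fin n) ℝ (EuclideanSpace ℝ (Fin n))
  side : Fin n → ℝ
  side_pos : ∀ i, 0 < side i

/-- The (closed) set of points of a rectangular box. -/
def RectBox.toSet {n : ℕ} (B : RectBox n) : Set (EuclideanSpace ℝ (Fin n)) :=
  {x | ∀ i, |inner ℝ (B.axes i) (x - B.center)| ≤ B.side i / 2}

/-- `B` has one side of length `δ ^ 2`, along its axis number `i₀`, and its other `n - 1` sides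
have length `δ`. -/
def RectBox.IsPlate {n : ℕ} (B : RectBox n) (i₀ : Fin n) (δ : ℝ) : Prop :=
  B.side i₀ = δ ^ 2 ∧ ∀ i, i ≠ i₀ → B.side i = δ

open FourierTransform in
/-- The Fourier transform of `f : ℝⁿ → ℂ` is supported in `S`. Either `f` is integrable and its
Fourier transform is `ξ ↦ ∫ f x * exp (-2πi x·ξ) dx`, or `f` is square integrable and its Fourier
transform is the `L²` one (Plancherel), which is defined up to null sets. -/
def FourierSupportedIn {n : ℕ} (f : EuclideanSpace ℝ (Fin n) → ℂ)
    (S : Set (EuclideanSpace ℝ (Fin n))) : Prop :=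
  (MeasureTheory.Integrable f ∧ Function.support (𝓕 f) ⊆ S) ∨
  ∃ hf : MeasureTheory.MemLp f 2,
    ∀ᵐ ξ, ξ ∉ S → (𝓕 (hf.toLp f) : MeasureTheory.Lp ℂ 2) ξ = 0

section PlateBilinear

open MeasureTheory FourierTransform SchwartzMap
open scoped ContDiff

section FourierL2

variable {V : Type*} [NormedAddCommGroup V] [InnerProductSpace ℝ V] [FiniteDimensional ℝ V]
  [MeasurableSpace V] [BorelSpace V]

theorem integral_mul_fourier_eq {f g : V → ℂ} (hf : Integrable f) (hg : Integrable g) :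
    ∫ x, f x * 𝓕 g x = ∫ x, 𝓕 f x * g x := by
  simpa using! (VectorFourier.integral_fourierIntegral_smul_eq_flip (L := innerₗ V)
    Real.continuous_fourierChar continuous_inner hf hg).symm

theorem integral_mul_fourierInv_eq {f g : V → ℂ} (hf : Integrable f) (hg : Integrable g) :
    ∫ x, f x * 𝓕⁻ g x = ∫ x, 𝓕⁻ f x * g x := by
  have h := integral_mul_fourier_eq hf hg.comp_neg
  simp only [Real.fourierInv_eq_fourier_comp_neg]
  rw [h, ← integral_neg_eq_self]
  simp [← Real.fourierInv_eq_fourier_neg, Real.fourierInv_eq_fourier_comp_neg]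

theorem ae_eq_of_integral_schwartz_mul_eq {f g : V → ℂ} (hf : LocallyIntegrable f)
    (hg : LocallyIntegrable g) (h : ∀ φ : 𝓢(V, ℂ), ∫ x, φ x * f x = ∫ x, φ x * g x) :
    f =ᵐ[volume] g := by
  refine ae_eq_of_integral_contDiff_smul_eq hf hg fun φ hφ hc ↦ ?_
  have hc' : HasCompactSupport (Complex.ofRealCLM ∘ φ) := hc.comp_left rfl
  have hφ' : ContDiff ℝ ∞ (Complex.ofRealCLM ∘ φ) := by fun_prop
  simpa using h (hc'.toSchwartzMap hφ')

theorem continuous_fourierInv_of_integrable {g : V → ℂ} (hg : Integrable g) :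
    Continuous (𝓕⁻ g) := by
  rw [Real.fourierInv_eq_fourier_comp_neg]
  exact VectorFourier.fourierIntegral_continuous Real.continuous_fourierChar
    continuous_inner hg.comp_neg

theorem fourierInv_toLp_ae_eq {g : V → ℂ} (hg : Integrable g) (hg2 : MemLp g 2) :
    (𝓕⁻ (hg2.toLp g) : Lp ℂ 2 (volume : Measure V)) =ᵐ[volume] 𝓕⁻ g := by
  refine ae_eq_of_integral_schwartz_mul_eq ((Lp.memLp _).locallyIntegrable (by norm_num))
    (continuous_fourierInv_of_integrable hg).locallyIntegrable fun φ ↦ ?_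
  have h := congrArg (fun T ↦ T φ) (Lp.fourierInv_toTemperedDistribution_eq (hg2.toLp g))
  simp only [TemperedDistribution.fourierInv_apply, Lp.toTemperedDistribution_apply,
    smul_eq_mul] at h
  rw [← h, integral_mul_fourierInv_eq φ.integrable hg]
  refine integral_congr_ae ?_
  filter_upwards [hg2.coeFn_toLp] with x hx
  rw [hx, SchwartzMap.fourierInv_coe]

theorem eLpNorm_fourierInv_eq {g : V → ℂ} (hg : Integrable g) (hg2 : MemLp g 2) :
    eLpNorm (𝓕⁻ g) 2 volume = eLpNorm g 2 volume := by
  rw [← eLpNorm_congr_ae (fourierInv_toLp_ae_eq hg hg2), ← eLpNorm_congr_ae hg2.coeFn_toLp,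
    ← Lp.enorm_def, ← Lp.enorm_def]
  have h : ‖𝓕⁻ (hg2.toLp g)‖ = ‖hg2.toLp g‖ := (Lp.fourierTransformₗᵢ V ℂ).symm.norm_map _
  rw [← ofReal_norm, h, ofReal_norm]

theorem ae_eq_fourierInv_fourier {f : V → ℂ} (hf : Integrable f) (hf' : Integrable (𝓕 f)) :
    f =ᵐ[volume] 𝓕⁻ (𝓕 f) := by
  refine ae_eq_of_integral_schwartz_mul_eq hf.locallyIntegrable
    (continuous_fourierInv_of_integrable hf').locallyIntegrable fun φ ↦ ?_
  rw [integral_mul_fourierInv_eq φ.integrable hf', ← SchwartzMap.fourierInv_coe,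
    integral_mul_fourier_eq (𝓕⁻ φ).integrable hf, ← SchwartzMap.fourier_coe,
    FourierTransform.fourier_fourierInv_eq]

theorem fourierInv_convolution_eq {g₁ g₂ : V → ℂ} (h₁ : Integrable g₁) (h₂ : Integrable g₂)
    (x : V) :
    𝓕⁻ (convolution g₁ g₂ (.mul ℂ ℂ) volume) x = 𝓕⁻ g₁ x * 𝓕⁻ g₂ x := by
  simp only [Real.fourierInv_eq_fourier_neg]
  exact Real.fourier_mul_convolution_eq h₁ h₂ (-x)

end FourierL2

theorem FourierSupportedIn.exists_ae_eq_fourierInv {n : ℕ} {f : EuclideanSpace ℝ (Fin n) → ℂ}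
    {S : Set (EuclideanSpace ℝ (Fin n))} (hf : FourierSupportedIn f S) (hS : MeasurableSet S)
    (hvol : volume S ≠ ⊤) :
    ∃ g : EuclideanSpace ℝ (Fin n) → ℂ, Integrable g ∧ MemLp g 2 ∧ Function.support g ⊆ S ∧
      f =ᵐ[volume] 𝓕⁻ g := by
  have : IsFiniteMeasure (volume.restrict S) := ⟨by simpa using hvol.lt_top⟩
  rcases hf with ⟨hf, hsupp⟩ | ⟨hf, hsupp⟩
  · have hcont : Continuous (𝓕 f) := VectorFourier.fourierIntegral_continuous
      Real.continuous_fourierChar continuous_inner hf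
    have hind : S.indicator (𝓕 f) = 𝓕 f := Set.indicator_eq_self.2 hsupp
    have hmem (p : ENNReal) : MemLp (𝓕 f) p := by
      rw [← hind, memLp_indicator_iff_restrict hS]
      refine MemLp.of_bound hcont.aestronglyMeasurable (∫ x, ‖f x‖) (.of_forall fun ξ ↦ ?_)
      exact VectorFourier.norm_fourierIntegral_le_integral_norm _ _ _ _ _
    have hint : Integrable (𝓕 f) := memLp_one_iff_integrable.1 (hmem 1)
    exact ⟨𝓕 f, hint, hmem 2, hsupp, ae_eq_fourierInv_fourier hf hint⟩
  · set G : Lp ℂ 2 (volume : Measure (EuclideanSpace ℝ (Fin n))) := 𝓕 (hf.toLp f) with hG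
    have hae : S.indicator G =ᵐ[volume] G := by
      filter_upwards [hsupp] with ξ hξ
      by_cases h : ξ ∈ S
      · simp [h]
      · simp [h, hξ h]
    have h2 : MemLp (S.indicator G) 2 := (Lp.memLp G).indicator hS
    have h1 : Integrable (S.indicator G) := by
      rw [integrable_indicator_iff hS]
      exact ((Lp.memLp G).restrict S).integrable (by norm_num)
    refine ⟨S.indicator G, h1, h2, Set.support_indicator_subset, ?_⟩
    have hLp : h2.toLp _ = G := Lp.ext (h2.coeFn_toLp.trans hae)
    have key := fourierInv_toLp_ae_eq h1 h2
    rw [hLp, hG, FourierTransform.fourierInv_fourier_eq] at key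
    exact hf.coeFn_toLp.symm.trans key

section Convolution

variable {V : Type*} [NormedAddCommGroup V] [InnerProductSpace ℝ V] [FiniteDimensional ℝ V]
  [MeasurableSpace V] [BorelSpace V]

/-- The `L²` norm of a convolution is controlled by the largest overlap of the support of one
factor with the reflected translates of the support of the other. -/
theorem eLpNorm_convolution_le_of_measure_inter_le {g₁ g₂ : V → ℂ} (h₁ : MemLp g₁ 2)
    (h₂ : MemLp g₂ 2) {S₁ S₂ : Set V} (hS₁ : Function.support g₁ ⊆ S₁)
    (hS₂ : Function.support g₂ ⊆ S₂) (hm₁ : MeasurableSet S₁) (hm₂ : MeasurableSet S₂)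
    {K : ENNReal} (hK : ∀ ξ, volume (S₁ ∩ {η | ξ - η ∈ S₂}) ≤ K) :
    eLpNorm (convolution g₁ g₂ (.mul ℂ ℂ) volume) 2 volume ≤
      K ^ (1 / 2 : ℝ) * (eLpNorm g₁ 2 volume * eLpNorm g₂ 2 volume) := by
  have hmeas₁ : AEMeasurable (fun η ↦ ‖g₁ η‖ₑ ^ (2 : ℝ)) volume := by
    have := h₁.1.enorm; fun_prop
  have hmeas₂ : AEMeasurable (fun η ↦ ‖g₂ η‖ₑ ^ (2 : ℝ)) volume := by
    have := h₂.1.enorm; fun_prop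
  have hq (ξ : V) : Measure.QuasiMeasurePreserving (fun η : V ↦ ξ - η) volume volume :=
    quasiMeasurePreserving_sub_left volume ξ
  have hprod : AEMeasurable (fun p : V × V ↦ ‖g₁ p.2‖ₑ ^ (2 : ℝ) * ‖g₂ (p.1 - p.2)‖ₑ ^ (2 : ℝ))
      (volume.prod volume) :=
    (hmeas₁.comp_quasiMeasurePreserving Measure.quasiMeasurePreserving_snd).mul
      (hmeas₂.comp_quasiMeasurePreserving
        (quasiMeasurePreserving_sub volume volume))
  have hpt (ξ : V) : ‖convolution g₁ g₂ (.mul ℂ ℂ) volume ξ‖ₑ ^ (2 : ℝ) ≤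
      K * ∫⁻ η, ‖g₁ η‖ₑ ^ (2 : ℝ) * ‖g₂ (ξ - η)‖ₑ ^ (2 : ℝ) := by
    set A : Set V := S₁ ∩ {η | ξ - η ∈ S₂} with hA
    have hAm : MeasurableSet A := hm₁.inter (hm₂.preimage (by fun_prop))
    have hF : AEMeasurable (fun η ↦ ‖g₁ η‖ₑ * ‖g₂ (ξ - η)‖ₑ) volume :=
      h₁.1.enorm.mul (h₂.1.enorm.comp_quasiMeasurePreserving (hq ξ))
    have hpw (η : V) : ‖g₁ η‖ₑ * ‖g₂ (ξ - η)‖ₑ =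
        A.indicator 1 η * (‖g₁ η‖ₑ * ‖g₂ (ξ - η)‖ₑ) := by
      by_cases h : η ∈ A
      · simp [h]
      · have : g₁ η = 0 ∨ g₂ (ξ - η) = 0 := by
          by_contra! hne
          exact h ⟨hS₁ hne.1, hS₂ hne.2⟩
        rcases this with h' | h' <;> simp [h']
    have hCS := ENNReal.lintegral_mul_le_Lp_mul_Lq volume Real.HolderConjugate.two_two
      (f := A.indicator 1) (measurable_one.indicator hAm).aemeasurable hF
    have hind : ∫⁻ η, (A.indicator (1 : V → ENNReal) η) ^ (2 : ℝ) = volume A := by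
      rw [← lintegral_indicator_one hAm]
      refine lintegral_congr fun η ↦ ?_
      by_cases h : η ∈ A <;> simp [h]
    rw [hind] at hCS
    calc ‖convolution g₁ g₂ (.mul ℂ ℂ) volume ξ‖ₑ ^ (2 : ℝ)
        ≤ (∫⁻ η, ‖g₁ η‖ₑ * ‖g₂ (ξ - η)‖ₑ) ^ (2 : ℝ) := by
          gcongr
          refine (enorm_integral_le_lintegral_enorm _).trans_eq ?_
          simp [enorm_mul]
      _ = (∫⁻ η, A.indicator 1 η * (‖g₁ η‖ₑ * ‖g₂ (ξ - η)‖ₑ)) ^ (2 : ℝ) := by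
          rw [lintegral_congr hpw]
      _ ≤ (volume A ^ (1 / 2 : ℝ) *
            (∫⁻ η, (‖g₁ η‖ₑ * ‖g₂ (ξ - η)‖ₑ) ^ (2 : ℝ)) ^ (1 / 2 : ℝ)) ^ (2 : ℝ) := by
          gcongr
          exact hCS
      _ = volume A * ∫⁻ η, ‖g₁ η‖ₑ ^ (2 : ℝ) * ‖g₂ (ξ - η)‖ₑ ^ (2 : ℝ) := by
          rw [ENNReal.mul_rpow_of_nonneg _ _ (by norm_num), ← ENNReal.rpow_mul,
            ← ENNReal.rpow_mul]
          simp only [ENNReal.mul_rpow_of_nonneg _ _ zero_le_two]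
          norm_num
      _ ≤ _ := by gcongr; exact hK ξ
  have hint : ∫⁻ ξ, ‖convolution g₁ g₂ (.mul ℂ ℂ) volume ξ‖ₑ ^ (2 : ℝ) ≤
      K * ((∫⁻ η, ‖g₁ η‖ₑ ^ (2 : ℝ)) * ∫⁻ η, ‖g₂ η‖ₑ ^ (2 : ℝ)) := by
    calc ∫⁻ ξ, ‖convolution g₁ g₂ (.mul ℂ ℂ) volume ξ‖ₑ ^ (2 : ℝ)
        ≤ ∫⁻ ξ, K * ∫⁻ η, ‖g₁ η‖ₑ ^ (2 : ℝ) * ‖g₂ (ξ - η)‖ₑ ^ (2 : ℝ) := lintegral_mono hpt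
      _ = K * ∫⁻ ξ, ∫⁻ η, ‖g₁ η‖ₑ ^ (2 : ℝ) * ‖g₂ (ξ - η)‖ₑ ^ (2 : ℝ) :=
          lintegral_const_mul'' _ hprod.lintegral_prod_right'
      _ = K * ∫⁻ η, ∫⁻ ξ, ‖g₁ η‖ₑ ^ (2 : ℝ) * ‖g₂ (ξ - η)‖ₑ ^ (2 : ℝ) := by
          rw [lintegral_lintegral_swap hprod]
      _ = K * ∫⁻ η, ‖g₁ η‖ₑ ^ (2 : ℝ) * ∫⁻ ξ, ‖g₂ ξ‖ₑ ^ (2 : ℝ) := by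
          congr 1
          refine lintegral_congr fun η ↦ ?_
          rw [lintegral_const_mul' _ _ (by finiteness),
            lintegral_sub_right_eq_self (fun ξ ↦ ‖g₂ ξ‖ₑ ^ (2 : ℝ)) η]
      _ = _ := by rw [lintegral_mul_const'' _ hmeas₁]
  simp only [eLpNorm_eq_lintegral_rpow_enorm_toReal two_ne_zero ENNReal.ofNat_ne_top,
    ENNReal.toReal_ofNat]
  rw [← ENNReal.mul_rpow_of_nonneg _ _ (by norm_num),
    ← ENNReal.mul_rpow_of_nonneg _ _ (by norm_num)]
  gcongr

/-- The `L²` norm of a product of two functions whose Fourier transforms live on sets with small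
mutual overlaps. -/
theorem eLpNorm_fourierInv_mul_fourierInv_le {g₁ g₂ : V → ℂ} (hi₁ : Integrable g₁)
    (hi₂ : Integrable g₂) (h₁ : MemLp g₁ 2) (h₂ : MemLp g₂ 2) {S₁ S₂ : Set V}
    (hS₁ : Function.support g₁ ⊆ S₁) (hS₂ : Function.support g₂ ⊆ S₂) (hm₁ : MeasurableSet S₁)
    (hm₂ : MeasurableSet S₂) {K : ENNReal} (hK' : K ≠ ⊤)
    (hK : ∀ ξ, volume (S₁ ∩ {η | ξ - η ∈ S₂}) ≤ K) :
    eLpNorm (fun x ↦ 𝓕⁻ g₁ x * 𝓕⁻ g₂ x) 2 volume ≤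
      K ^ (1 / 2 : ℝ) * (eLpNorm (𝓕⁻ g₁) 2 volume * eLpNorm (𝓕⁻ g₂) 2 volume) := by
  have hle := eLpNorm_convolution_le_of_measure_inter_le h₁ h₂ hS₁ hS₂ hm₁ hm₂ hK
  have hint : Integrable (convolution g₁ g₂ (.mul ℂ ℂ) volume) := hi₁.integrable_convolution _ hi₂
  have hmem : MemLp (convolution g₁ g₂ (.mul ℂ ℂ) volume) 2 :=
    ⟨hint.1, hle.trans_lt (ENNReal.mul_lt_top (by finiteness)
      (ENNReal.mul_lt_top h₁.2 h₂.2))⟩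
  rw [eLpNorm_fourierInv_eq hi₁ h₁, eLpNorm_fourierInv_eq hi₂ h₂]
  simp only [← fourierInv_convolution_eq hi₁ hi₂]
  exact (eLpNorm_fourierInv_eq hint hmem).trans_le hle

end Convolution

section CubeSlab

theorem Real.sin_sq_mul_one_add_le (x : ℝ) : Real.sin x ^ 2 * (1 + x ^ 2 / 4) ≤ x ^ 2 := by
  rcases le_total (x ^ 2) 2 with h | h
  · have h1 : Real.sin x ^ 2 = 4 * Real.sin (x / 2) ^ 2 * (1 - Real.sin (x / 2) ^ 2) := by
      rw [← Real.cos_sq', show x = 2 * (x / 2) by ring, Real.sin_two_mul]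
      ring_nf
    have h2 : Real.sin (x / 2) ^ 2 ≤ (x / 2) ^ 2 := Real.sin_sq_le_sq
    have h3 : Real.sin x ^ 2 ≤ x ^ 2 * (1 - x ^ 2 / 4) := by
      rw [h1]
      nlinarith [sq_nonneg (Real.sin (x / 2))]
    nlinarith [mul_le_mul_of_nonneg_right h3 (by positivity : 0 ≤ 1 + x ^ 2 / 4),
      mul_nonneg (sq_nonneg x) (sq_nonneg (x ^ 2))]
  · nlinarith [Real.sin_sq_le_one x, sq_nonneg x]

theorem norm_integral_cexp_le {s : ℝ} (hs : 0 < s) (θ : ℝ) :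
    ‖∫ y in Set.Icc (-(s / 2)) (s / 2), Complex.exp (Complex.I * θ * y)‖ ^ 2 *
      (1 + (θ * s) ^ 2 / 16) ≤ s ^ 2 := by
  rw [integral_Icc_eq_integral_Ioc, ← intervalIntegral.integral_of_le (by linarith)]
  rcases eq_or_ne θ 0 with rfl | hθ
  · simp
  have hI : Complex.I * θ ≠ 0 := by simp [hθ]
  have h : ∫ y in (-(s / 2))..(s / 2), Complex.exp (Complex.I * θ * y) =
      ((2 * Real.sin (θ * s / 2) / θ : ℝ) : ℂ) := by
    rw [integral_exp_mul_complex hI, div_eq_iff hI]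
    push_cast
    rw [Complex.sin]
    have e1 : Complex.I * θ * (s / 2) = θ * s / 2 * Complex.I := by ring
    have e2 : Complex.I * θ * -(s / 2) = -(θ * s / 2) * Complex.I := by ring
    have hθ' : (θ : ℂ) ≠ 0 := by exact_mod_cast hθ
    rw [e1, e2]
    generalize Complex.exp (θ * s / 2 * Complex.I) = a
    generalize Complex.exp (-(θ * s / 2) * Complex.I) = b
    field_simp
    linear_combination (a - b) * Complex.I_sq
  rw [h, Complex.norm_real, Real.norm_eq_abs, sq_abs]
  have := Real.sin_sq_mul_one_add_le (θ * s / 2)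
  rw [div_pow, div_mul_eq_mul_div, div_le_iff₀ (by positivity)]
  nlinarith

theorem one_add_sum_add_le_prod_one_add {ι : Type*} (T : Finset ι) {a : ι → ℝ}
    (ha : ∀ i, 0 ≤ a i) :
    1 + ∑ i ∈ T, a i + ((∑ i ∈ T, a i) ^ 2 - ∑ i ∈ T, a i ^ 2) / 2 ≤ ∏ i ∈ T, (1 + a i) := by
  classical
  have hsq (T : Finset ι) : 0 ≤ (∑ i ∈ T, a i) ^ 2 - ∑ i ∈ T, a i ^ 2 :=
    sub_nonneg.2 (Finset.sum_sq_le_sq_sum_of_nonneg fun i _ ↦ ha i)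
  induction T using Finset.induction_on with
  | empty => simp
  | insert j T hj ih =>
    rw [Finset.sum_insert hj, Finset.sum_insert hj, Finset.prod_insert hj]
    nlinarith [mul_le_mul_of_nonneg_left ih (by linarith [ha j] : 0 ≤ 1 + a j),
      mul_nonneg (ha j) (hsq T)]

theorem sq_one_add_half_sum_le_prod_one_add {ι : Type*} [Fintype ι] {a : ι → ℝ}
    (ha : ∀ i, 0 ≤ a i) (hmax : ∀ i, a i ≤ (∑ j, a j) / 2) :
    (1 + (∑ i, a i) / 2) ^ 2 ≤ ∏ i, (1 + a i) := by
  refine le_trans ?_ (one_add_sum_add_le_prod_one_add Finset.univ ha)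
  have : ∑ i, a i ^ 2 ≤ (∑ i, a i) ^ 2 / 2 := by
    calc ∑ i, a i ^ 2 ≤ ∑ i, a i * ((∑ j, a j) / 2) :=
          Finset.sum_le_sum fun i _ ↦ by nlinarith [ha i, hmax i]
      _ = _ := by rw [← Finset.sum_mul]; ring
  nlinarith

variable {ι : Type*} [Fintype ι]

/-- The part of the box with side lengths `s i` on which the linear form `β` is within `t / 2`
of `r`. -/
def boxSlab (s β : ι → ℝ) (r t : ℝ) : Set (ι → ℝ) :=
  {y | (∀ i, |y i| ≤ s i / 2) ∧ |∑ i, β i * y i - r| ≤ t / 2}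

theorem volume_boxSlab_le_of_coordinate {s β : ι → ℝ} (hs : ∀ i, 0 < s i) {r t : ℝ} (ht : 0 < t)
    {j : ι} (hj : β j ≠ 0) :
    volume (boxSlab s β r t) ≤ ENNReal.ofReal (t * (∏ i, s i) / |β j * s j|) := by
  classical
  set M : Matrix ι ι ℝ := (1 : Matrix ι ι ℝ).updateRow j β with hM
  have hdet : M.det = β j := by
    rw [hM, ← Matrix.cramer_transpose_apply]
    simp
  have hLdet : LinearMap.det (Matrix.toLin' M) = β j := by rw [LinearMap.det_toLin', hdet]
  set u : ι → ℝ := Function.update (fun i ↦ s i / 2) j (t / 2) with hu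
  set c : ι → ℝ := Function.update (fun _ ↦ (0 : ℝ)) j r with hc
  have hsub : boxSlab s β r t ⊆ Matrix.toLin' M ⁻¹' Set.Icc (c - u) (c + u) := by
    rintro y ⟨hy, hyt⟩
    have hmem : ∀ i, |(Matrix.toLin' M y) i - c i| ≤ u i := by
      intro i
      rcases eq_or_ne i j with rfl | hij
      · simpa [hM, hu, hc, Matrix.mulVec, dotProduct] using hyt
      · simpa [hM, hu, hc, Matrix.mulVec, dotProduct, Matrix.updateRow_ne hij, hij,
          Matrix.one_apply] using hy i
    refine ⟨fun i ↦ ?_, fun i ↦ ?_⟩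
    · have := abs_le.1 (hmem i); simp only [Pi.sub_apply]; linarith
    · have := abs_le.1 (hmem i); simp only [Pi.add_apply]; linarith
  refine (measure_mono hsub).trans ?_
  rw [Measure.addHaar_preimage_linearMap volume (by rwa [hLdet]), hLdet, Real.volume_Icc_pi]
  have hu2 : ∀ i, (c + u) i - (c - u) i = Function.update s j t i := by
    intro i
    rcases eq_or_ne i j with rfl | hij
    · simp [hu]
    · simp [hu, hij]
  simp only [hu2]
  have hup : ∀ i, 0 ≤ Function.update s j t i := by
    intro i
    rcases eq_or_ne i j with rfl | hij
    · simp [ht.le]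
    · simp [hij, (hs i).le]
  rw [← ENNReal.ofReal_prod_of_nonneg fun i _ ↦ hup i, ← ENNReal.ofReal_mul (abs_nonneg _)]
  refine (congrArg ENNReal.ofReal ?_).le
  rw [Finset.prod_update_of_mem (Finset.mem_univ j), ← Finset.mul_prod_erase Finset.univ s
    (Finset.mem_univ j), Finset.sdiff_singleton_eq_erase, abs_mul, abs_of_pos (hs j), abs_inv]
  have := (hs j).ne'
  have := abs_ne_zero.2 hj
  field_simp

theorem prod_norm_integral_cexp_le {s β : ι → ℝ} (hs : ∀ i, 0 < s i)
    (hmax : ∀ i, (β i * s i) ^ 2 ≤ (∑ j, (β j * s j) ^ 2) / 2) (u : ℝ) :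
    ∏ i, ‖∫ y in Set.Icc (-(s i / 2)) (s i / 2), Complex.exp (Complex.I * (β i * u : ℝ) * y)‖ ≤
      (∏ i, s i) * (1 + u ^ 2 * (∑ i, (β i * s i) ^ 2) / 32)⁻¹ := by
  set φ : ι → ℝ := fun i ↦
    ‖∫ y in Set.Icc (-(s i / 2)) (s i / 2), Complex.exp (Complex.I * (β i * u : ℝ) * y)‖
  have hφ (i : ι) : 0 ≤ φ i := norm_nonneg _
  set a : ι → ℝ := fun i ↦ (β i * u * s i) ^ 2 / 16
  have hsum : ∑ i, a i = u ^ 2 * (∑ i, (β i * s i) ^ 2) / 16 := by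
    rw [Finset.mul_sum, Finset.sum_div]
    exact Finset.sum_congr rfl fun i _ ↦ by simp only [a]; ring
  have hA : 0 ≤ ∑ i, (β i * s i) ^ 2 := Finset.sum_nonneg fun i _ ↦ sq_nonneg _
  have hlow := sq_one_add_half_sum_le_prod_one_add (a := a) (fun i ↦ by positivity) fun i ↦ by
    rw [hsum]
    simp only [a]
    nlinarith [mul_le_mul_of_nonneg_left (hmax i) (sq_nonneg u)]
  have hprod : (∏ i, φ i) ^ 2 * ∏ i, (1 + a i) ≤ (∏ i, s i) ^ 2 := by
    rw [← Finset.prod_pow, ← Finset.prod_pow, ← Finset.prod_mul_distrib]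
    exact Finset.prod_le_prod (fun i _ ↦ by positivity)
      fun i _ ↦ norm_integral_cexp_le (hs i) (β i * u)
  have hP : 0 ≤ ∏ i, φ i := Finset.prod_nonneg fun i _ ↦ hφ i
  have hS : 0 ≤ ∏ i, s i := Finset.prod_nonneg fun i _ ↦ (hs i).le
  have hpos : 0 < 1 + u ^ 2 * (∑ i, (β i * s i) ^ 2) / 32 := by positivity
  rw [← div_eq_mul_inv, le_div_iff₀ hpos]
  refine abs_le_of_sq_le_sq' ?_ hS |>.2
  rw [mul_pow]
  refine le_trans (mul_le_mul_of_nonneg_left ?_ (sq_nonneg _)) hprod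
  rw [hsum] at hlow
  exact le_of_eq_of_le (by ring) hlow

theorem integral_inv_one_add_sq_mul {A : ℝ} (hA : 0 < A) :
    Integrable (fun u : ℝ ↦ (1 + u ^ 2 * A / 32)⁻¹) ∧
      ∫ u : ℝ, (1 + u ^ 2 * A / 32)⁻¹ = √(32 / A) * Real.pi := by
  have hfun : (fun u : ℝ ↦ (1 + u ^ 2 * A / 32)⁻¹) =
      fun u ↦ (fun v : ℝ ↦ (1 + v ^ 2)⁻¹) (√(A / 32) * u) := by
    ext u
    simp only [mul_pow, Real.sq_sqrt (by positivity : 0 ≤ A / 32)]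
    ring_nf
  have hne : √(A / 32) ≠ 0 := by positivity
  rw [hfun]
  refine ⟨integrable_inv_one_add_sq.comp_mul_left' hne, ?_⟩
  rw [Measure.integral_comp_mul_left (fun v : ℝ ↦ (1 + v ^ 2)⁻¹), integral_univ_inv_one_add_sq, smul_eq_mul, ← Real.sqrt_inv,
    inv_div, abs_of_nonneg (Real.sqrt_nonneg _)]

theorem integral_exp_neg_sq_box_le {s β : ι → ℝ} (hs : ∀ i, 0 < s i) {r t : ℝ} (ht : 0 < t)
    (hσ : 0 < ∑ i, (β i * s i) ^ 2)
    (hmax : ∀ i, (β i * s i) ^ 2 ≤ (∑ j, (β j * s j) ^ 2) / 2) :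
    ∫ y : ι → ℝ, Real.exp (-((∑ i, β i * y i - r) ^ 2 / t ^ 2))
        ∂Measure.pi (fun i ↦ volume.restrict (Set.Icc (-(s i / 2)) (s i / 2))) ≤
      6 * (∏ i, s i) * t / √(∑ i, (β i * s i) ^ 2) := by
  set A := ∑ i, (β i * s i) ^ 2 with hA
  set P : Measure (ι → ℝ) :=
    Measure.pi (fun i ↦ volume.restrict (Set.Icc (-(s i / 2)) (s i / 2)))
  set w : (ι → ℝ) → ℝ := fun y ↦ ∑ i, β i * y i - r with hw
  set b : ℝ := t ^ 2 / 4 with hb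
  have hb0 : 0 < b := by positivity
  set F : (ι → ℝ) → ℝ → ℂ := fun y u ↦
    Complex.exp (Complex.I * w y * u) * Complex.exp (-b * u ^ 2) with hF
  have hFnorm (y : ι → ℝ) (u : ℝ) : ‖F y u‖ = Real.exp (-b * u ^ 2) := by
    simp only [hF, norm_mul, Complex.norm_exp]
    norm_num [← Complex.ofReal_pow]
  have hint : Integrable (Function.uncurry F) (P.prod volume) := by
    refine ((integrable_exp_neg_mul_sq hb0).comp_snd P).mono ?_ (.of_forall fun p ↦ ?_)
    · have : Continuous (Function.uncurry F) := by
        simp only [hF, hw, Function.uncurry_def]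
        fun_prop
      exact this.aestronglyMeasurable
    · simp [Function.uncurry, hFnorm]
  have hgauss (y : ι → ℝ) : ∫ u, F y u =
      (Real.pi / b : ℂ) ^ (1 / 2 : ℂ) * (Real.exp (-(w y ^ 2 / t ^ 2)) : ℝ) := by
    rw [hF, fourierIntegral_gaussian (b := (b : ℂ)) (by simpa using hb0) (w y : ℂ)]
    congr 1
    push_cast [hb]
    congr 1
    field_simp
  have hinner (u : ℝ) : ‖∫ y, F y u ∂P‖ ≤ (∏ i, s i) * (1 + u ^ 2 * A / 32)⁻¹ := by
    have hfac (y : ι → ℝ) : F y u = (Complex.exp (-(Complex.I * r * u)) *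
        Complex.exp (-b * u ^ 2)) *
          ∏ i, Complex.exp (Complex.I * (β i * u : ℝ) * (y i : ℝ)) := by
      rw [← Complex.exp_sum, hF]
      simp only [← Complex.exp_add, hw]
      congr 1
      push_cast
      rw [mul_sub, sub_mul, Finset.mul_sum, Finset.sum_mul]
      rw [Finset.sum_congr rfl fun i _ ↦
        show Complex.I * (β i * u) * (y i : ℂ) = Complex.I * (β i * y i) * u by ring]
      ring
    simp only [hfac]
    rw [integral_const_mul, integral_fintype_prod_eq_prod (𝕜 := ℂ)
      (fun i (x : ℝ) ↦ Complex.exp (Complex.I * (β i * u : ℝ) * x)), norm_mul, norm_prod]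
    refine le_trans (mul_le_of_le_one_left (by positivity) ?_)
      (prod_norm_integral_cexp_le hs hmax u)
    simp only [norm_mul, Complex.norm_exp]
    norm_num [← Complex.ofReal_pow]
    positivity
  obtain ⟨hI, hIval⟩ := integral_inv_one_add_sq_mul hσ
  have hswap : ‖∫ y, (∫ u, F y u) ∂P‖ ≤ (∏ i, s i) * (√(32 / A) * Real.pi) := by
    rw [integral_integral_swap hint]
    calc _ ≤ ∫ u, (∏ i, s i) * (1 + u ^ 2 * A / 32)⁻¹ :=
          norm_integral_le_of_norm_le (hI.const_mul _) (.of_forall hinner)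
      _ = _ := by rw [integral_const_mul, hIval]
  simp only [hgauss] at hswap
  rw [integral_const_mul, integral_complex_ofReal, norm_mul, ← Complex.ofReal_div,
    Complex.norm_cpow_eq_rpow_re_of_pos (by positivity), Complex.norm_real, Real.norm_eq_abs,
    abs_of_nonneg (by positivity)] at hswap
  have hre : (1 / 2 : ℂ).re = 1 / 2 := by norm_num
  have hroot : √(Real.pi / b) = 2 * √Real.pi / t := by
    rw [hb, Real.sqrt_eq_iff_mul_self_eq (by positivity) (by positivity)]
    have := Real.mul_self_sqrt Real.pi_pos.le
    field_simp
    nlinarith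
  have hc : √32 * √Real.pi ≤ 12 := by
    rw [← Real.sqrt_mul (by norm_num)]
    exact Real.sqrt_le_iff.2 ⟨by norm_num, by linarith [Real.pi_lt_four]⟩
  rw [hre, ← Real.sqrt_eq_rpow, hroot, Real.sqrt_div (by norm_num), div_mul_eq_mul_div,
    div_le_iff₀ ht] at hswap
  have hS : 0 < ∏ i, s i := Finset.prod_pos fun i _ ↦ hs i
  have hπ : 0 < √Real.pi := Real.sqrt_pos.2 Real.pi_pos
  have hA' : 0 < √A := Real.sqrt_pos.2 hσ
  refine le_of_mul_le_mul_left (hswap.trans ?_) (mul_pos two_pos hπ)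
  calc (∏ i, s i) * (√32 / √A * Real.pi) * t
      = (√32 * √Real.pi) * (√Real.pi * (∏ i, s i) * t / √A) := by
        nth_rewrite 1 [← Real.mul_self_sqrt Real.pi_pos.le]
        ring
    _ ≤ 12 * (√Real.pi * (∏ i, s i) * t / √A) := by gcongr
    _ = _ := by ring

/-- Up to an absolute constant, the volume of the intersection of a box with a slab is what it
would be if the slab were orthogonal to an edge of the box; the constant does not depend on the
dimension. -/
theorem volume_boxSlab_le {s β : ι → ℝ} (hs : ∀ i, 0 < s i) {r t : ℝ} (ht : 0 < t)
    (hσ : 0 < ∑ i, (β i * s i) ^ 2) :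
    volume (boxSlab s β r t) ≤
      ENNReal.ofReal (12 * (∏ i, s i) * t / √(∑ i, (β i * s i) ^ 2)) := by
  set A := ∑ i, (β i * s i) ^ 2 with hA
  have hS : 0 < ∏ i, s i := Finset.prod_pos fun i _ ↦ hs i
  have hA' : 0 < √A := Real.sqrt_pos.2 hσ
  by_cases hmax : ∀ i, (β i * s i) ^ 2 ≤ A / 2
  · set P : Measure (ι → ℝ) :=
      Measure.pi (fun i ↦ volume.restrict (Set.Icc (-(s i / 2)) (s i / 2))) with hP
    have hP' : P = volume.restrict (Set.univ.pi fun i ↦ Set.Icc (-(s i / 2)) (s i / 2)) := by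
      rw [hP, volume_pi, Measure.restrict_pi_pi]
    set w : (ι → ℝ) → ℝ := fun y ↦ ∑ i, β i * y i - r with hw
    have hwc : Continuous w := by fun_prop
    have hset : boxSlab s β r t =
        {y | |w y| ≤ t / 2} ∩ Set.univ.pi fun i ↦ Set.Icc (-(s i / 2)) (s i / 2) := by
      ext y
      simp only [boxSlab, hw, abs_le, Set.mem_inter_iff, Set.mem_univ_pi, Set.mem_Icc,
        Set.mem_ofPred_eq]
      exact and_comm
    have hmeas : MeasurableSet {y | |w y| ≤ t / 2} :=
      measurableSet_le hwc.abs.measurable measurable_const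
    have hvol : volume (boxSlab s β r t) = P {y | |w y| ≤ t / 2} := by
      rw [hset, hP', Measure.restrict_apply hmeas]
    have hint : Integrable (fun y ↦ Real.exp (-(w y ^ 2 / t ^ 2))) P := by
      refine (integrable_const (1 : ℝ)).mono (by fun_prop) (.of_forall fun y ↦ ?_)
      rw [Real.norm_eq_abs, Real.abs_exp, norm_one, Real.exp_le_one_iff]
      have : 0 ≤ w y ^ 2 / t ^ 2 := by positivity
      linarith
    have hle := integral_exp_neg_sq_box_le (r := r) hs ht hσ hmax
    have hind : P.real {y | |w y| ≤ t / 2} ≤ 2 * ∫ y, Real.exp (-(w y ^ 2 / t ^ 2)) ∂P := by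
      rw [← integral_const_mul, ← integral_indicator_one hmeas]
      refine integral_mono ((integrable_const 1).indicator hmeas) (hint.const_mul 2) fun y ↦ ?_
      by_cases hy : |w y| ≤ t / 2
      · have h1 : w y ^ 2 / t ^ 2 ≤ 1 / 4 := by
          rw [div_le_iff₀ (by positivity)]
          nlinarith [sq_abs (w y), abs_nonneg (w y)]
        have h2 := Real.add_one_le_exp (-(w y ^ 2 / t ^ 2))
        simp only [Set.indicator, Set.mem_ofPred_eq, hy, if_true, Pi.one_apply]
        linarith
      · simp only [Set.indicator, Set.mem_ofPred_eq, hy, if_false]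
        positivity
    rw [hvol, ← ofReal_measureReal]
    refine ENNReal.ofReal_le_ofReal (hind.trans ?_)
    calc _ ≤ 2 * (6 * (∏ i, s i) * t / √A) := by gcongr
      _ = _ := by ring
  · push Not at hmax
    obtain ⟨j, hj⟩ := hmax
    have hj0 : β j ≠ 0 := by
      rintro h
      simp only [h, zero_mul, ne_eq, OfNat.ofNat_ne_zero, not_false_eq_true, zero_pow] at hj
      linarith
    have hroot : √A ≤ 12 * |β j * s j| := by
      rw [Real.sqrt_le_iff]
      refine ⟨by positivity, ?_⟩
      rw [mul_pow, sq_abs]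
      linarith
    have hpos : 0 < |β j * s j| := abs_pos.2 (mul_ne_zero hj0 (hs j).ne')
    refine (volume_boxSlab_le_of_coordinate hs ht hj0).trans (ENNReal.ofReal_le_ofReal ?_)
    rw [div_le_div_iff₀ hpos hA']
    calc _ ≤ t * (∏ i, s i) * (12 * |β j * s j|) := by gcongr
      _ = _ := by ring

end CubeSlab

namespace RectBox

variable {n : ℕ}

/-- The coordinates of a point with respect to the centre and the axes of a box. -/
noncomputable def coord (B : RectBox n) (x : EuclideanSpace ℝ (Fin n)) : Fin n → ℝ :=
  WithLp.ofLp (B.axes.repr (x - B.center))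

theorem coord_apply (B : RectBox n) (x : EuclideanSpace ℝ (Fin n)) (i : Fin n) :
    B.coord x i = inner ℝ (B.axes i) (x - B.center) :=
  B.axes.repr_apply_apply _ _

theorem measurePreserving_coord (B : RectBox n) : MeasurePreserving B.coord :=
  (PiLp.volume_preserving_ofLp (Fin n)).comp
    (B.axes.measurePreserving_repr.comp (measurePreserving_sub_right volume B.center))

theorem toSet_eq_preimage (B : RectBox n) :
    B.toSet = B.coord ⁻¹' Set.univ.pi fun i ↦ Set.Icc (-(B.side i / 2)) (B.side i / 2) := by
  ext x
  simp only [toSet, Set.mem_ofPred_eq, Set.mem_preimage, Set.mem_univ_pi, Set.mem_Icc, coord_apply,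
    abs_le]

theorem measurableSet_toSet (B : RectBox n) : MeasurableSet B.toSet := by
  rw [toSet_eq_preimage]
  exact B.measurePreserving_coord.measurable
    (MeasurableSet.univ_pi fun _ ↦ measurableSet_Icc)

theorem volume_toSet_ne_top (B : RectBox n) : volume B.toSet ≠ ⊤ := by
  rw [toSet_eq_preimage, B.measurePreserving_coord.measure_preimage
    (MeasurableSet.univ_pi fun _ ↦ measurableSet_Icc).nullMeasurableSet, volume_pi_pi]
  exact ENNReal.prod_ne_top fun i _ ↦ by simp

theorem IsPlate.prod_side {B : RectBox n} {i₀ : Fin n} {δ : ℝ} (hB : B.IsPlate i₀ δ) :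
    ∏ i, B.side i = δ ^ (n + 1) := by
  rw [← Finset.mul_prod_erase Finset.univ _ (Finset.mem_univ i₀), hB.1,
    Finset.prod_congr rfl fun i hi ↦ hB.2 i (Finset.ne_of_mem_erase hi)]
  have : n - 1 + 1 = n := Nat.succ_pred_eq_of_pos i₀.pos
  simp only [Finset.prod_const, Finset.card_erase_of_mem (Finset.mem_univ i₀), Finset.card_univ,
    Fintype.card_fin, ← pow_add]
  congr 1
  omega

theorem IsPlate.sq_mul_sin_sq_le {B : RectBox n} {i₀ : Fin n} {δ : ℝ} (hB : B.IsPlate i₀ δ)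
    {a : EuclideanSpace ℝ (Fin n)} (ha : ‖a‖ = 1) :
    (δ * Real.sin (InnerProductGeometry.angle (B.axes i₀) a)) ^ 2 ≤
      ∑ i, (inner ℝ a (B.axes i) * B.side i) ^ 2 := by
  have hcos : Real.cos (InnerProductGeometry.angle (B.axes i₀) a) = inner ℝ a (B.axes i₀) := by
    rw [InnerProductGeometry.cos_angle, ha, B.axes.norm_eq_one, real_inner_comm]
    simp
  have hsum : ∑ i, (inner ℝ a (B.axes i)) ^ 2 = (1 : ℝ) := by
    simpa [ha] using B.axes.sum_sq_norm_inner_left a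
  rw [mul_pow, Real.sin_sq, hcos, ← hsum]
  have hle : ∑ i ∈ Finset.univ.erase i₀, (inner ℝ a (B.axes i) * B.side i) ^ 2 ≤
      ∑ i, (inner ℝ a (B.axes i) * B.side i) ^ 2 :=
    Finset.sum_le_sum_of_subset_of_nonneg (Finset.erase_subset _ _) fun _ _ _ ↦ sq_nonneg _
  refine le_trans (le_of_eq ?_) hle
  rw [← Finset.add_sum_erase Finset.univ _ (Finset.mem_univ i₀), add_sub_cancel_left,
    Finset.mul_sum]
  refine Finset.sum_congr rfl fun i hi ↦ ?_
  rw [hB.2 i (Finset.ne_of_mem_erase hi)]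
  ring

/-- Two plates whose short sides form an angle `ν` overlap in a set of volume `O(δ ^ (n + 2))`,
with a constant that depends only on `ν`. -/
theorem volume_plate_inter_le {B₁ B₂ : RectBox n} {i₁ i₂ : Fin n} {δ ν : ℝ} (hδ : 0 < δ)
    (hν : 0 < ν) (hν' : ν < Real.pi) (h₁ : B₁.IsPlate i₁ δ) (h₂ : B₂.IsPlate i₂ δ)
    (hangle : InnerProductGeometry.angle (B₁.axes i₁) (B₂.axes i₂) = ν)
    (ξ : EuclideanSpace ℝ (Fin n)) :
    volume (B₁.toSet ∩ {η | ξ - η ∈ B₂.toSet}) ≤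
      ENNReal.ofReal (12 / Real.sin ν * δ ^ (n + 2)) := by
  set a := B₂.axes i₂ with ha
  set β : Fin n → ℝ := fun i ↦ inner ℝ a (B₁.axes i)
  set r : ℝ := inner ℝ a (ξ - B₂.center - B₁.center)
  have hsin : 0 < Real.sin ν := Real.sin_pos_of_pos_of_lt_pi hν hν'
  have hlow := h₁.sq_mul_sin_sq_le (B₂.axes.norm_eq_one i₂)
  rw [hangle] at hlow
  have hσ : 0 < ∑ i, (β i * B₁.side i) ^ 2 := lt_of_lt_of_le (by positivity) hlow
  have hsub : B₁.toSet ∩ {η | ξ - η ∈ B₂.toSet} ⊆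
      B₁.coord ⁻¹' boxSlab B₁.side β r (δ ^ 2) := by
    rintro η ⟨hη₁, hη₂⟩
    refine ⟨fun i ↦ by rw [coord_apply]; exact hη₁ i, ?_⟩
    have h := hη₂ i₂
    rw [h₂.1, ← ha] at h
    have hsum : ∑ i, β i * B₁.coord η i = inner ℝ a (η - B₁.center) := by
      simp only [coord_apply]
      exact B₁.axes.sum_inner_mul_inner a _
    have hdiff : inner ℝ a (η - B₁.center) - r = -inner ℝ a (ξ - η - B₂.center) := by
      rw [← inner_sub_right, ← inner_neg_right]
      congr 1
      abel
    rwa [hsum, hdiff, abs_neg]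
  have hclosed : MeasurableSet (boxSlab B₁.side β r (δ ^ 2)) := by
    refine IsClosed.measurableSet ?_
    simp only [boxSlab, Set.ofPred_and, Set.ofPred_forall]
    exact (isClosed_iInter fun i ↦ isClosed_le (by fun_prop) (by fun_prop)).inter
      (isClosed_le (by fun_prop) (by fun_prop))
  calc volume (B₁.toSet ∩ {η | ξ - η ∈ B₂.toSet})
      ≤ volume (B₁.coord ⁻¹' boxSlab B₁.side β r (δ ^ 2)) := measure_mono hsub
    _ = volume (boxSlab B₁.side β r (δ ^ 2)) :=
        B₁.measurePreserving_coord.measure_preimage hclosed.nullMeasurableSet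
    _ ≤ _ := volume_boxSlab_le B₁.side_pos (by positivity) hσ
    _ ≤ ENNReal.ofReal (12 * δ ^ (n + 1) * δ ^ 2 / (δ * Real.sin ν)) := by
        rw [h₁.prod_side]
        gcongr
        exact Real.le_sqrt_of_sq_le hlow
    _ = _ := by
        congr 1
        field_simp
        ring

end RectBox

end PlateBilinear

open MeasureTheory in
theorem lemma3p3 (ν : ℝ) (hν : 0 < ν) (hν' : ν < Real.pi) :
    ∃ C : NNReal, ∀ (n : ℕ), 2 ≤ n → ∀ (δ : ℝ), 0 < δ → δ ≤ 1 →
      ∀ (B₁ B₂ : RectBox n) (i₁ i₂ : Fin n), B₁.IsPlate i₁ δ → B₂.IsPlate i₂ δ →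
      InnerProductGeometry.angle (B₁.axes i₁) (B₂.axes i₂) = ν →
      ∀ f₁ f₂ : EuclideanSpace ℝ (Fin n) → ℂ,
        FourierSupportedIn f₁ B₁.toSet → FourierSupportedIn f₂ B₂.toSet →
        eLpNorm (fun x => ‖f₁ x * f₂ x‖ ^ (1 / 2 : ℝ)) 4 volume ≤
          C * ENNReal.ofReal (δ ^ (((n : ℝ) + 2) / 4)) *
            (eLpNorm f₁ 2 volume * eLpNorm f₂ 2 volume) ^ (1 / 2 : ℝ) := by
  have hsin : 0 < Real.sin ν := Real.sin_pos_of_pos_of_lt_pi hν hν'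
  refine ⟨(12 / Real.sin ν).toNNReal ^ (1 / 4 : ℝ), ?_⟩
  intro n _ δ hδ _ B₁ B₂ i₁ i₂ h₁ h₂ hangle f₁ f₂ hf₁ hf₂
  obtain ⟨g₁, hi₁, hm₁, hs₁, hae₁⟩ :=
    hf₁.exists_ae_eq_fourierInv B₁.measurableSet_toSet B₁.volume_toSet_ne_top
  obtain ⟨g₂, hi₂, hm₂, hs₂, hae₂⟩ :=
    hf₂.exists_ae_eq_fourierInv B₂.measurableSet_toSet B₂.volume_toSet_ne_top
  have key := eLpNorm_fourierInv_mul_fourierInv_le hi₁ hi₂ hm₁ hm₂ hs₁ hs₂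
    B₁.measurableSet_toSet B₂.measurableSet_toSet ENNReal.ofReal_ne_top
    (RectBox.volume_plate_inter_le hδ hν hν' h₁ h₂ hangle)
  rw [← eLpNorm_congr_ae hae₁, ← eLpNorm_congr_ae hae₂] at key
  replace key := (eLpNorm_congr_ae (hae₁.mul hae₂)).trans_le key
  have hfour : (4 : ENNReal) * ENNReal.ofReal (1 / 2) = 2 := by
    rw [show (4 : ENNReal) = ENNReal.ofReal 4 by simp, ← ENNReal.ofReal_mul (by norm_num)]
    norm_num
  rw [eLpNorm_norm_rpow _ (by norm_num : (0 : ℝ) < 1 / 2), hfour]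
  refine (ENNReal.rpow_le_rpow key (by norm_num : (0 : ℝ) ≤ 1 / 2)).trans_eq ?_
  rw [ENNReal.mul_rpow_of_nonneg _ _ (by norm_num), ← ENNReal.rpow_mul]
  congr 1
  rw [ENNReal.ofReal_mul (by positivity), ENNReal.mul_rpow_of_nonneg _ _ (by norm_num),
    ENNReal.ofReal_rpow_of_nonneg (x := δ ^ (n + 2)) (by positivity) (by norm_num),
    ENNReal.coe_rpow_of_nonneg _ (by norm_num), ← Real.rpow_natCast, ← Real.rpow_mul hδ.le]
  congr 2
  · norm_num
  · push_cast
    ring_nf
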